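/- Call $p\in\mathbb{R}[z_1,\dots,z_n]$ *multiaffine* if it has degree at most one in each variable, and *real stable* if $p(z_1,\dots,z_n)\neq 0$ whenever $\operatorname{Im} z_i>0$ for all $i$. A point $\mathbf{a}\in\mathbb{R}^n$ is *above the roots* of $p$ if $p(\mathbf{a}+\mathbf{t})\neq 0$ for every $\mathbf{t}\in\mathbb{R}^n$ with nonnegative coordinates. For multiaffine real stable $p,q\in\mathbb{R}[z_1,\dots,z_n]$ their convolution $p\ast q$ is the polynomial determined by $$(p\ast q)(2z_1,\dots,2z_n)=\left[\frac{\partial^n}{\partial z_1\cdots\partial z_n}(pq)\right](z_1,\dots,z_n).$$ **Proposition.** Let $p,q\in\mathbb{R}[z_1,\dots,z_n]$ be multiaffine real stable polynomials such that $p\ast q$ is not the zero polynomial. Let $\mathbf{a}$ and $\mathbf{b}$ be above the roots of $p$ and $q$ respectively, and let $\varphi_1,\varphi_2\in\mathbb{R}$ satisfy $$\frac{\partial_i p}{p}(\mathbf{a})\le\varphi_1,\qquad \frac{\partial_i q}{q}(\mathbf{b})\le\varphi_2,\qquad i=1,\dots,n.$$ Then the point $$\mathbf{c}=\mathbf{a}+\mathbf{b}-\frac{1}{\varphi_1+\varphi_2}\mathbf{1}$$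 is above the roots of $p\ast q$, and moreover $$\frac{\partial_i(p\ast q)}{p\ast q}(\mathbf{c})\le\frac{\varphi_1+\varphi_2}{2},\qquad i=1,\dots,n.$$ (For $n\ge 1$ the hypotheses force $\varphi_1+\varphi_2>0$.) -/

import Mathlib

namespace StableConvolution

/-- A polynomial with real coefficients is real stable if it has no zero all of whose coordinates
lie in the open upper half plane. -/
def IsRealStable {n : ℕ} (p : MvPolynomial (Fin n) ℝ) : Prop :=
  ∀ z : Fin n → ℂ, (∀ i, 0 < (z i).im) → MvPolynomial.aeval z p ≠ 0

/-- A polynomial is multiaffine if its degree in each single variable is at most one. -/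
def IsMultiaffine {n : ℕ} (p : MvPolynomial (Fin n) ℝ) : Prop :=
  ∀ i, p.degreeOf i ≤ 1

/-- The point `a` is above the roots of `p` if `p` does not vanish on `a` plus the closed
nonnegative orthant. -/
def AboveRoots {n : ℕ} (p : MvPolynomial (Fin n) ℝ) (a : Fin n → ℝ) : Prop :=
  ∀ t : Fin n → ℝ, (∀ i, 0 ≤ t i) → MvPolynomial.eval (a + t) p ≠ 0

/-- The logarithmic potential `(∂ₖ p / p)(a)`. -/
noncomputable def potential {n : ℕ} (p : MvPolynomial (Fin n) ℝ) (k : Fin n)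
    (a : Fin n → ℝ) : ℝ :=
  MvPolynomial.eval a (MvPolynomial.pderiv k p) / MvPolynomial.eval a p

/-- The mixed partial derivative `∂ⁿ f / ∂z₁ ⋯ ∂zₙ`, once in each variable. -/
noncomputable def mixedDeriv {n : ℕ} (f : MvPolynomial (Fin n) ℝ) : MvPolynomial (Fin n) ℝ :=
  (List.finRange n).foldr (fun i g => MvPolynomial.pderiv i g) f

/-- The convolution of `p` and `q`: the polynomial `p ∗ q` determined by
`(p ∗ q)(2z) = [∂ⁿ (p q) / ∂z₁ ⋯ ∂zₙ](z)`, that is, the mixed derivative of `p q` with `z / 2`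
substituted for `z`. -/
noncomputable def convolution {n : ℕ} (p q : MvPolynomial (Fin n) ℝ) :
    MvPolynomial (Fin n) ℝ :=
  MvPolynomial.aeval (fun i => MvPolynomial.C (1 / 2 : ℝ) * MvPolynomial.X i) (mixedDeriv (p * q))

/-- The defining property of the convolution. -/
theorem eval_convolution_two_mul {n : ℕ} (p q : MvPolynomial (Fin n) ℝ) (z : Fin n → ℝ) :
    MvPolynomial.eval (fun i => 2 * z i) (convolution p q)
      = MvPolynomial.eval z (mixedDeriv (p * q)) := by
  unfold convolution
  generalize mixedDeriv (p * q) = f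
  induction f using MvPolynomial.induction_on with
  | C a => simp
  | add f g hf hg => simp only [map_add, hf, hg]
  | mul_X f i hf =>
    simp only [map_mul, hf, MvPolynomial.aeval_X, MvPolynomial.eval_C, MvPolynomial.eval_X]
    ring

end StableConvolution

/-! Separate the variables: put `f(x, y) = p(x) q(y)`, affine in each of its 2n variables. On the
diagonal `x = y = z`, differentiating `pq` in `zᵢ` is applying `∂/∂xᵢ + ∂/∂yᵢ` to `f`. After all n
operators the result depends only on `x + y`, so it is `(p ∗ q)(x + y)`
(`iterDiagDiff_pairProduct`), and the operators can be treated one at a time.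

Stability is used only through the Rayleigh inequalities, which hold at all real points after every
stage (`isRayleigh_iterDiagDiff`). They make all potentials decreasing above the roots.

One operator is a barrier step (`barrier_diagDiff`): lowering `xᵢ` by `1/(φ₁ + φ₂)` keeps the new
function positive, its potentials in `xᵢ` and `yᵢ` are at most `(φ₁ + φ₂)/2`, and bounds in all
other variables survive (`shifted_other_le`, the algebraic core). Iterating lowers `x` by `1/(φ₁ +
φ₂)` in every coordinate and leaves `y` alone; the sum of the two points is `c`. -/

namespace StableConvolution

/-! ### Calculus of functions affine in each variable. -/

section Affine

variable {ι K : Type*} [DecidableEq ι] [CommRing K]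

/-- The forward difference of `f` in direction `i`; for functions that are affine in each variable
it is the partial derivative. -/
def partialDiff (i : ι) (f : (ι → K) → K) : (ι → K) → K :=
  fun z => f (z + Pi.single i 1) - f z

/-- A function that is affine in each variable separately. -/
def SeparatelyAffine (f : (ι → K) → K) : Prop :=
  ∀ (i : ι) (z : ι → K) (t : K), f (z + Pi.single i t) = f z + t * partialDiff i f z

theorem partialDiff_comm (i j : ι) (f : (ι → K) → K) :
    partialDiff i (partialDiff j f) = partialDiff j (partialDiff i f) := by
  funext z
  simp only [partialDiff, add_right_comm z (Pi.single i 1) (Pi.single j 1)]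
  ring

theorem SeparatelyAffine.partialDiff {f : (ι → K) → K} (hf : SeparatelyAffine f) (j : ι) :
    SeparatelyAffine (partialDiff j f) := by
  intro i z t
  have h := hf i (z + Pi.single j 1) t
  have h' := hf i z t
  simp only [StableConvolution.partialDiff] at h h' ⊢
  rw [add_right_comm z (Pi.single i t), h, h', add_right_comm z (Pi.single i 1)]
  ring

theorem SeparatelyAffine.add {f g : (ι → K) → K} (hf : SeparatelyAffine f)
    (hg : SeparatelyAffine g) : SeparatelyAffine (f + g) := by
  intro i z t
  simp only [Pi.add_apply, hf i z t, hg i z t, StableConvolution.partialDiff]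
  ring

theorem SeparatelyAffine.const_mul {f : (ι → K) → K} (hf : SeparatelyAffine f) (c : K) :
    SeparatelyAffine (fun z => c * f z) := by
  intro i z t
  simp only [hf i z t, StableConvolution.partialDiff]
  ring

theorem SeparatelyAffine.partialDiff_self {f : (ι → K) → K} (hf : SeparatelyAffine f) (i : ι)
    (z : ι → K) (t : K) :
    StableConvolution.partialDiff i f (z + Pi.single i t)
      = StableConvolution.partialDiff i f z := by
  have h1 := hf i z (t + 1)
  have h2 := hf i z t
  rw [Pi.single_add, ← add_assoc] at h1
  rw [StableConvolution.partialDiff, h1, h2]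
  ring

theorem SeparatelyAffine.partialDiff_partialDiff_self {f : (ι → K) → K}
    (hf : SeparatelyAffine f) (i : ι) (z : ι → K) :
    StableConvolution.partialDiff i (StableConvolution.partialDiff i f) z = 0 := by
  rw [StableConvolution.partialDiff, hf.partialDiff_self, sub_self]

end Affine

/-! ### The operators `∂/∂xᵢ + ∂/∂yᵢ` and dependence on `x + y`. -/

section Diagonal

variable {κ K : Type*} [DecidableEq κ] [CommRing K]

/-- The operator `∂/∂xᵢ + ∂/∂yᵢ` on functions of the two families of variables `x` and `y`. -/
def diagDiff (i : κ) (f : (κ ⊕ κ → K) → K) : (κ ⊕ κ → K) → K :=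
  partialDiff (Sum.inl i) f + partialDiff (Sum.inr i) f

theorem SeparatelyAffine.diagDiff {f : (κ ⊕ κ → K) → K} (hf : SeparatelyAffine f) (i : κ) :
    SeparatelyAffine (diagDiff i f) :=
  (hf.partialDiff _).add (hf.partialDiff _)

theorem partialDiff_add {ι : Type*} [DecidableEq ι] (i : ι) (f g : (ι → K) → K) :
    partialDiff i (f + g) = partialDiff i f + partialDiff i g := by
  funext z
  simp only [partialDiff, Pi.add_apply]
  ring

theorem partialDiff_diagDiff (i : κ) (j : κ ⊕ κ) (f : (κ ⊕ κ → K) → K) :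
    partialDiff j (diagDiff i f)
      = partialDiff (Sum.inl i) (partialDiff j f) + partialDiff (Sum.inr i) (partialDiff j f) := by
  rw [diagDiff, partialDiff_add, partialDiff_comm j, partialDiff_comm j]

/-- The composition of the operators `∂/∂xᵢ + ∂/∂yᵢ` over a list of indices. -/
def iterDiagDiff (L : List κ) (f : (κ ⊕ κ → K) → K) : (κ ⊕ κ → K) → K :=
  L.foldr diagDiff f

theorem SeparatelyAffine.iterDiagDiff {f : (κ ⊕ κ → K) → K} (hf : SeparatelyAffine f)
    (L : List κ) : SeparatelyAffine (iterDiagDiff L f) := by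
  induction L with
  | nil => exact hf
  | cons i L ih => exact ih.diagDiff i

/-- Invariance under translations that keep `xᵢ + yᵢ`. -/
def DependsOnSum (i : κ) (f : (κ ⊕ κ → K) → K) : Prop :=
  ∀ (z : κ ⊕ κ → K) (t : K), f (z + Pi.single (Sum.inl i) t + Pi.single (Sum.inr i) (-t)) = f z

theorem DependsOnSum.diagDiff {i : κ} {f : (κ ⊕ κ → K) → K} (hf : DependsOnSum i f) (j : κ) :
    DependsOnSum i (diagDiff j f) := by
  have key : ∀ k : κ ⊕ κ, ∀ (z : κ ⊕ κ → K) (t : K),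
      partialDiff k f (z + Pi.single (Sum.inl i) t + Pi.single (Sum.inr i) (-t))
        = partialDiff k f z := by
    intro k z t
    simp only [partialDiff]
    rw [add_right_comm _ _ (Pi.single k 1), add_right_comm z _ (Pi.single k 1), hf, hf]
  intro z t
  simp only [StableConvolution.diagDiff, Pi.add_apply, key]

/-- In the two variables concerned, `α + βx + γy + δxy` is sent to `β + γ + δ(x + y)`. -/
theorem SeparatelyAffine.dependsOnSum_diagDiff {f : (κ ⊕ κ → K) → K} (hf : SeparatelyAffine f)
    (i : κ) : DependsOnSum i (StableConvolution.diagDiff i f) := by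
  intro z t
  have hx := hf.partialDiff (Sum.inl i)
  have hy := hf.partialDiff (Sum.inr i)
  simp only [StableConvolution.diagDiff, Pi.add_apply]
  rw [hx, hf.partialDiff_self, hf.partialDiff_self, hy, partialDiff_comm (Sum.inr i),
    hy.partialDiff_self]
  ring

theorem dependsOnSum_iterDiagDiff {f : (κ ⊕ κ → K) → K} (hf : SeparatelyAffine f)
    (L : List κ) {i : κ} (hi : i ∈ L) : DependsOnSum i (iterDiagDiff L f) := by
  induction L with
  | nil => simp at hi
  | cons j L ih =>
    rcases List.mem_cons.1 hi with rfl | h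
    · exact (hf.iterDiagDiff L).dependsOnSum_diagDiff i
    · exact (ih h).diagDiff j

theorem eq_of_forall_dependsOnSum [Fintype κ] {f : (κ ⊕ κ → K) → K}
    (hf : ∀ i, DependsOnSum i f) {z w : κ ⊕ κ → K}
    (h : ∀ i, z (Sum.inl i) + z (Sum.inr i) = w (Sum.inl i) + w (Sum.inr i)) : f z = f w := by
  have key : ∀ (s : Finset κ) (d : κ → K), f (z + Sum.elim (fun i => if i ∈ s then d i else 0)
      (fun i => if i ∈ s then - d i else 0)) = f z := by
    intro s d
    induction s using Finset.induction_on with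
    | empty => congr 1; ext (i | i) <;> simp
    | insert a s ha ih =>
      rw [← ih, ← hf a (z + Sum.elim (fun i => if i ∈ s then d i else 0)
        (fun i => if i ∈ s then - d i else 0)) (d a)]
      congr 1
      ext (i | i) <;> by_cases hia : i = a <;> simp [hia, ha]
  rw [← key Finset.univ (fun i => w (Sum.inl i) - z (Sum.inl i))]
  congr 1
  ext (i | i)
  · simp
  · simp only [Pi.add_apply, Sum.elim_inr, Finset.mem_univ, if_true]
    linear_combination h i

end Diagonal

/-! ### Half-plane inequalities from stability. -/

section Rayleigh

variable {ι : Type*} [DecidableEq ι]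

/-- The Rayleigh inequalities `f ∂ᵢ∂ⱼ f ≤ ∂ᵢ f ∂ⱼ f` at all real points. -/
def IsRayleigh (f : (ι → ℝ) → ℝ) : Prop :=
  ∀ i j, i ≠ j → ∀ z,
    f z * partialDiff i (partialDiff j f) z ≤ partialDiff i f z * partialDiff j f z

/-- A function of complex variables without zeros in the product of the open upper half planes. -/
def NonvanishingUpper (f : (ι → ℂ) → ℂ) : Prop :=
  ∀ z : ι → ℂ, (∀ i, 0 < (z i).im) → f z ≠ 0

open ComplexConjugate

/-- As an affine function of the i-th coordinate, `f` has its root at `zᵢ - f/∂ᵢf`; a negative sign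
here would put that root in the open upper half plane. -/
theorem NonvanishingUpper.im_nonneg {f : (ι → ℂ) → ℂ} (hf : NonvanishingUpper f)
    (ha : SeparatelyAffine f) (i : ι) {z : ι → ℂ} (hz : ∀ i, 0 < (z i).im) :
    0 ≤ (f z * conj (partialDiff i f z)).im := by
  by_contra! hneg
  set d := partialDiff i f z with hd
  have hd0 : d ≠ 0 := by
    intro h
    simp [h] at hneg
  have hn : 0 < Complex.normSq d := Complex.normSq_pos.2 hd0
  refine hf (z + Pi.single i (-(f z / d))) (fun j => ?_) ?_
  · by_cases hj : j = i
    · subst hj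
      have : (f z / d).im = (f z * conj d).im / Complex.normSq d := by
        rw [Complex.div_im, Complex.mul_im, Complex.conj_re, Complex.conj_im]
        field_simp
        ring
      have h2 : (f z * conj d).im / Complex.normSq d < 0 := div_neg_of_neg_of_pos hneg hn
      have h3 := hz j
      simp only [Pi.add_apply, Pi.single_eq_same, Complex.add_im, Complex.neg_im, this]
      linarith
    · simpa [hj] using hz j
  · rw [ha, ← hd]
    field_simp
    ring

theorem NonvanishingUpper.im_nonneg_of_continuous {f : (ι → ℂ) → ℂ} (hf : NonvanishingUpper f)
    (ha : SeparatelyAffine f) (hc : Continuous f) (i : ι) {z : ι → ℂ} (hz : ∀ i, 0 ≤ (z i).im) :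
    0 ≤ (f z * conj (partialDiff i f z)).im := by
  have hcont : Continuous fun η : ℝ => (f (z + fun _ => (η : ℂ) * Complex.I) *
      conj (partialDiff i f (z + fun _ => (η : ℂ) * Complex.I))).im := by
    have hp : Continuous (partialDiff i f) := by unfold partialDiff; fun_prop
    have hl : Continuous fun η : ℝ => (z + fun _ => (η : ℂ) * Complex.I) := by fun_prop
    exact Complex.continuous_im.comp
      ((hc.comp hl).mul (Complex.continuous_conj.comp (hp.comp hl)))
  have hlim := (hcont.tendsto 0).mono_left (nhdsWithin_le_nhds (s := Set.Ioi 0))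
  have h0 : (z + fun _ => ((0 : ℝ) : ℂ) * Complex.I) = z := by ext; simp
  rw [h0] at hlim
  refine ge_of_tendsto hlim ?_
  filter_upwards [self_mem_nhdsWithin] with η hη
  refine hf.im_nonneg ha i fun j => ?_
  have := hz j
  simp only [Set.mem_Ioi] at hη
  simp
  linarith

end Rayleigh

/-! ### Rayleigh inequalities survive the operators. -/

section Perturbation

open ComplexConjugate

variable {κ : Type*} [DecidableEq κ]

/-- The operators `∂/∂xᵢ + ∂/∂yᵢ - ε√-1` composed over a list of indices. -/
noncomputable def perturbedDiff (ε : ℝ) (f : (κ ⊕ κ → ℂ) → ℂ) : List κ → (κ ⊕ κ → ℂ) → ℂ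
  | [] => f
  | i :: L => diagDiff i (perturbedDiff ε f L)
      + fun z => (-(ε : ℂ) * Complex.I) * perturbedDiff ε f L z

theorem perturbedDiff_zero (f : (κ ⊕ κ → ℂ) → ℂ) (L : List κ) :
    perturbedDiff 0 f L = iterDiagDiff L f := by
  induction L with
  | nil => rfl
  | cons i L ih =>
    funext z
    simp [perturbedDiff, ih, iterDiagDiff]

theorem SeparatelyAffine.perturbedDiff {f : (κ ⊕ κ → ℂ) → ℂ} (hf : SeparatelyAffine f) (ε : ℝ)
    (L : List κ) : SeparatelyAffine (perturbedDiff ε f L) := by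
  induction L with
  | nil => exact hf
  | cons i L ih => exact (ih.diagDiff i).add (ih.const_mul _)

theorem continuous_perturbedDiff {f : (κ ⊕ κ → ℂ) → ℂ} (hf : Continuous f) (ε : ℝ)
    (L : List κ) : Continuous (perturbedDiff ε f L) := by
  induction L with
  | nil => exact hf
  | cons i L ih =>
    refine Continuous.add ?_ (continuous_const.mul ih)
    unfold diagDiff partialDiff
    exact ((ih.comp (by fun_prop)).sub ih).add ((ih.comp (by fun_prop)).sub ih)

theorem continuous_perturbedDiff_param (f : (κ ⊕ κ → ℂ) → ℂ) (L : List κ) (z : κ ⊕ κ → ℂ) :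
    Continuous fun ε : ℝ => perturbedDiff ε f L z := by
  induction L generalizing z with
  | nil => exact continuous_const
  | cons i L ih =>
    simp only [perturbedDiff, diagDiff, partialDiff, Pi.add_apply]
    exact (((ih _).sub (ih _)).add ((ih _).sub (ih _))).add
      ((Continuous.mul (by fun_prop) continuous_const).mul (ih _))

/-- A zero would give `u + v = iεg` for the two derivatives of `g`, hence `Im (g conj(u + v)) =
-ε|g|² < 0`, against the half-plane inequalities. The perturbation makes this strict; only closed
inequalities are later taken to the limit `ε → 0`. -/
theorem nonvanishingUpper_perturbedDiff {f : (κ ⊕ κ → ℂ) → ℂ} (hf : NonvanishingUpper f)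
    (ha : SeparatelyAffine f) {ε : ℝ} (hε : 0 < ε) (L : List κ) :
    NonvanishingUpper (perturbedDiff ε f L) := by
  induction L with
  | nil => exact hf
  | cons i L ih =>
    intro z hz h0
    have hx := ih.im_nonneg (ha.perturbedDiff ε L) (Sum.inl i) hz
    have hy := ih.im_nonneg (ha.perturbedDiff ε L) (Sum.inr i) hz
    have hne := ih z hz
    simp only [perturbedDiff, diagDiff, Pi.add_apply] at h0
    set g := perturbedDiff ε f L z
    set u := partialDiff (Sum.inl i) (perturbedDiff ε f L) z
    set v := partialDiff (Sum.inr i) (perturbedDiff ε f L) z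
    have huv : u + v = ε * Complex.I * g := by linear_combination h0
    have hsum : (g * conj u).im + (g * conj v).im = - (ε * Complex.normSq g) := by
      rw [← Complex.add_im, ← mul_add, ← map_add, huv]
      simp [Complex.normSq_apply]
      ring
    have := mul_pos hε (Complex.normSq_pos.2 hne)
    linarith

/-- The real and the complex version of a function agree at real points. -/
def Extends {ι : Type*} (F : (ι → ℂ) → ℂ) (f : (ι → ℝ) → ℝ) : Prop :=
  ∀ x : ι → ℝ, F (fun i => (x i : ℂ)) = f x

theorem Extends.partialDiff {ι : Type*} [DecidableEq ι] {F : (ι → ℂ) → ℂ} {f : (ι → ℝ) → ℝ}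
    (h : Extends F f) (i : ι) : Extends (partialDiff i F) (partialDiff i f) := by
  intro x
  have : (fun j => (x j : ℂ)) + Pi.single i 1
      = fun j => (((x + Pi.single i 1 : ι → ℝ) j : ℝ) : ℂ) := by
    ext j
    by_cases hj : j = i
    · subst hj; simp
    · simp [hj]
  rw [StableConvolution.partialDiff, StableConvolution.partialDiff, this, h, h]
  push_cast
  rfl

theorem Extends.iterDiagDiff {F : (κ ⊕ κ → ℂ) → ℂ} {f : (κ ⊕ κ → ℝ) → ℝ} (h : Extends F f)
    (L : List κ) : Extends (iterDiagDiff L F) (iterDiagDiff L f) := by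
  induction L with
  | nil => exact h
  | cons i L ih =>
    intro x
    have h1 := ih.partialDiff (Sum.inl i) x
    have h2 := ih.partialDiff (Sum.inr i) x
    simp only [StableConvolution.iterDiagDiff, List.foldr_cons, diagDiff, Pi.add_apply] at h1 h2 ⊢
    rw [h1, h2]
    push_cast
    rfl

/-- At `x + √-1 eⱼ` the imaginary part is exactly `∂ᵢf ∂ⱼf - f ∂ᵢ∂ⱼf`. -/
theorem isRayleigh_of_im_nonneg {ι : Type*} [DecidableEq ι] {F : (ι → ℂ) → ℂ} {f : (ι → ℝ) → ℝ}
    (hF : SeparatelyAffine F) (h : Extends F f)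
    (him : ∀ (i : ι) (z : ι → ℂ), (∀ j, 0 ≤ (z j).im) → 0 ≤ (F z * conj (partialDiff i F z)).im) :
    IsRayleigh f := by
  intro i j _ x
  have h1 := him i ((fun k => (x k : ℂ)) + Pi.single j Complex.I) fun k => by
    by_cases hk : k = j
    · subst hk; simp
    · simp [hk]
  rw [hF, (hF.partialDiff i), h, h.partialDiff, h.partialDiff, (h.partialDiff i).partialDiff j] at h1
  rw [partialDiff_comm]
  simp at h1
  linarith

theorem isRayleigh_iterDiagDiff {F : (κ ⊕ κ → ℂ) → ℂ} {f : (κ ⊕ κ → ℝ) → ℝ}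
    (hF : SeparatelyAffine F) (hc : Continuous F) (hn : NonvanishingUpper F) (h : Extends F f)
    (L : List κ) : IsRayleigh (iterDiagDiff L f) := by
  refine isRayleigh_of_im_nonneg (hF.iterDiagDiff L) (h.iterDiagDiff L) fun i z hz => ?_
  have hcont : Continuous fun ε : ℝ => (perturbedDiff ε F L z *
      conj (partialDiff i (perturbedDiff ε F L) z)).im := by
    refine Complex.continuous_im.comp ((continuous_perturbedDiff_param F L z).mul
      (Complex.continuous_conj.comp ?_))
    exact (continuous_perturbedDiff_param F L _).sub (continuous_perturbedDiff_param F L z)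
  have hlim := (hcont.tendsto 0).mono_left (nhdsWithin_le_nhds (s := Set.Ioi 0))
  rw [perturbedDiff_zero] at hlim
  refine ge_of_tendsto hlim ?_
  filter_upwards [self_mem_nhdsWithin] with ε hε
  exact (nonvanishingUpper_perturbedDiff hn hF hε L).im_nonneg_of_continuous
    (hF.perturbedDiff ε L) (continuous_perturbedDiff hc ε L) i hz

end Perturbation

end StableConvolution

namespace StableConvolution

/-! ### From polynomials to separately affine functions. -/

section Polynomial

open MvPolynomial

variable {n : ℕ}

theorem IsMultiaffine.separatelyAffine {K : Type*} [CommRing K] [Algebra ℝ K]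
    {p : MvPolynomial (Fin n) ℝ} (hp : IsMultiaffine p) :
    SeparatelyAffine (fun z : Fin n → K => aeval z p) := by
  intro i z t
  have key : ∀ m ∈ p.support, ∀ s : K, ∏ j, (z + Pi.single i s : Fin n → K) j ^ m j
      = ∏ j, z j ^ m j + s * (∏ j, (z + Pi.single i 1 : Fin n → K) j ^ m j - ∏ j, z j ^ m j) := by
    intro m hm s
    have h1 : m i ≤ 1 := (degreeOf_le_iff.1 (hp i)) m hm
    have hprod : ∀ s : K, ∏ j, (z + Pi.single i s : Fin n → K) j ^ m j
        = (z i + s) ^ m i * ∏ j ∈ Finset.univ.erase i, z j ^ m j := by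
      intro s
      rw [← Finset.mul_prod_erase _ _ (Finset.mem_univ i)]
      congr 1
      · simp
      · refine Finset.prod_congr rfl fun j hj => ?_
        simp [Finset.ne_of_mem_erase hj]
    have h0 := hprod 0
    simp only [Pi.single_zero, add_zero] at h0
    rw [hprod, hprod, h0]
    interval_cases m i <;> ring
  simp only [partialDiff, aeval_def, eval₂_eq']
  rw [← Finset.sum_sub_distrib, Finset.mul_sum, ← Finset.sum_add_distrib]
  refine Finset.sum_congr rfl fun m hm => ?_
  rw [key m hm t]
  ring

theorem hasDerivAt_eval_add_single (g : MvPolynomial (Fin n) ℝ) (i : Fin n) (z : Fin n → ℝ) :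
    HasDerivAt (fun t : ℝ => eval (z + Pi.single i t) g) (eval z (pderiv i g)) 0 := by
  induction g using MvPolynomial.induction_on with
  | C a => simpa using hasDerivAt_const (0 : ℝ) a
  | add f g hf hg =>
    simp only [map_add]
    exact hf.add hg
  | mul_X f j hf =>
    have hX : HasDerivAt (fun t : ℝ => (z + Pi.single i t : Fin n → ℝ) j)
        ((Pi.single i 1 : Fin n → ℝ) j) 0 := by
      by_cases h : j = i
      · subst h
        simpa using (hasDerivAt_id (0 : ℝ)).const_add (z j)
      · simpa [h] using hasDerivAt_const (0 : ℝ) (z j)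
    have := hf.mul hX
    simp only [Pi.single_zero, add_zero] at this
    simp only [map_mul, eval_X, pderiv_mul, pderiv_X, map_add]
    refine this.congr_deriv ?_
    by_cases h : j = i
    · subst h; simp
    · simp [h]

/-- The quadratic term is needed because `pq` has degree up to two in each variable. -/
theorem eval_pderiv_eq_of_forall {g : MvPolynomial (Fin n) ℝ} {i : Fin n} {z : Fin n → ℝ}
    {α β γ : ℝ} (h : ∀ t : ℝ, eval (z + Pi.single i t) g = α + t * β + t * t * γ) :
    eval z (pderiv i g) = β := by
  refine (hasDerivAt_eval_add_single g i z).unique ?_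
  simp only [h]
  have h1 := ((hasDerivAt_id (0 : ℝ)).mul_const β).const_add α
  have h2 := ((hasDerivAt_id (0 : ℝ)).mul (hasDerivAt_id (0 : ℝ))).mul_const γ
  refine (h1.add h2).congr_deriv ?_
  simp

theorem IsMultiaffine.eval_pderiv {p : MvPolynomial (Fin n) ℝ} (hp : IsMultiaffine p) (i : Fin n)
    (z : Fin n → ℝ) : eval z (pderiv i p) = partialDiff i (fun z => eval z p) z := by
  refine eval_pderiv_eq_of_forall (α := eval z p) (γ := 0) fun t => ?_
  have := hp.separatelyAffine (K := ℝ) i z t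
  simpa [aeval_eq_eval] using this

/-- The function `(x, y) ↦ p(x) q(y)`. -/
noncomputable def pairProduct {K : Type*} [CommRing K] [Algebra ℝ K]
    (p q : MvPolynomial (Fin n) ℝ) : (Fin n ⊕ Fin n → K) → K :=
  fun z => aeval (fun i => z (Sum.inl i)) p * aeval (fun i => z (Sum.inr i)) q

section

variable {K : Type*} [CommRing K] [Algebra ℝ K] (p q : MvPolynomial (Fin n) ℝ)

theorem pairProduct_add_single_inl (z : Fin n ⊕ Fin n → K) (i : Fin n) (t : K) :
    pairProduct p q (z + Pi.single (Sum.inl i) t)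
      = aeval ((fun i => z (Sum.inl i)) + Pi.single i t) p * aeval (fun i => z (Sum.inr i)) q := by
  unfold pairProduct
  congr 3
  · ext j
    by_cases h : j = i
    · subst h; simp
    · simp [h]
  · ext j
    simp

theorem pairProduct_add_single_inr (z : Fin n ⊕ Fin n → K) (i : Fin n) (t : K) :
    pairProduct p q (z + Pi.single (Sum.inr i) t)
      = aeval (fun i => z (Sum.inl i)) p * aeval ((fun i => z (Sum.inr i)) + Pi.single i t) q := by
  unfold pairProduct
  congr 3
  · ext j
    simp
  · ext j
    by_cases h : j = i
    · subst h; simp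
    · simp [h]

variable {p q}

theorem separatelyAffine_pairProduct (hp : IsMultiaffine p) (hq : IsMultiaffine q) :
    SeparatelyAffine (pairProduct (K := K) p q) := by
  rintro (i | i) z t
  · have := hp.separatelyAffine (K := K) i (fun i => z (Sum.inl i)) t
    simp only [partialDiff, pairProduct_add_single_inl] at this ⊢
    rw [this, pairProduct]
    ring
  · have := hq.separatelyAffine (K := K) i (fun i => z (Sum.inr i)) t
    simp only [partialDiff, pairProduct_add_single_inr] at this ⊢
    rw [this, pairProduct]
    ring

end

variable {p q : MvPolynomial (Fin n) ℝ}

theorem isRayleigh_iterDiagDiff_pairProduct (hp : IsMultiaffine p) (hq : IsMultiaffine q)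
    (hps : IsRealStable p) (hqs : IsRealStable q) (L : List (Fin n)) :
    IsRayleigh (iterDiagDiff L (pairProduct (K := ℝ) p q)) := by
  refine isRayleigh_iterDiagDiff (F := pairProduct (K := ℂ) p q)
    (separatelyAffine_pairProduct hp hq) ?_ ?_ ?_ L
  · have hcont : ∀ g : MvPolynomial (Fin n) ℝ, Continuous fun z : Fin n → ℂ => aeval z g := by
      intro g
      simp only [aeval_def, eval₂_eq']
      fun_prop
    exact ((hcont p).comp (by fun_prop)).mul ((hcont q).comp (by fun_prop))
  · intro z hz
    exact mul_ne_zero (hps _ fun i => hz _) (hqs _ fun i => hz _)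
  · have hreal : ∀ (g : MvPolynomial (Fin n) ℝ) (x : Fin n → ℝ),
        aeval (fun i => (x i : ℂ)) g = ((aeval x g : ℝ) : ℂ) := by
      intro g x
      exact aeval_algebraMap_apply ℂ x g
    intro x
    simp only [pairProduct, hreal]
    push_cast
    rfl

theorem eval_foldr_pderiv (hp : IsMultiaffine p) (hq : IsMultiaffine q) (L : List (Fin n))
    (z : Fin n → ℝ) :
    eval z (L.foldr (fun i g => pderiv i g) (p * q))
      = iterDiagDiff L (pairProduct (K := ℝ) p q) (Sum.elim z z) := by
  induction L generalizing z with
  | nil => simp [iterDiagDiff, pairProduct, aeval_eq_eval]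
  | cons i L ih =>
    set H := iterDiagDiff L (pairProduct (K := ℝ) p q) with hH
    have hHa : SeparatelyAffine H := (separatelyAffine_pairProduct hp hq).iterDiagDiff L
    rw [List.foldr_cons]
    refine eval_pderiv_eq_of_forall (α := H (Sum.elim z z))
      (γ := partialDiff (Sum.inl i) (partialDiff (Sum.inr i) H) (Sum.elim z z)) fun t => ?_
    have hs : Sum.elim (z + Pi.single i t) (z + Pi.single i t)
        = Sum.elim z z + Pi.single (Sum.inl i) t + Pi.single (Sum.inr i) t := by
      ext (j | j) <;> by_cases h : j = i <;> simp [h]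
    rw [ih, hs, hHa, hHa, (hHa.partialDiff _), iterDiagDiff, List.foldr_cons, diagDiff]
    simp only [Pi.add_apply]
    change _ = _ + t * (partialDiff (Sum.inl i) H _ + partialDiff (Sum.inr i) H _) + _
    ring

theorem iterDiagDiff_pairProduct (hp : IsMultiaffine p) (hq : IsMultiaffine q)
    (w : Fin n ⊕ Fin n → ℝ) :
    iterDiagDiff (List.finRange n) (pairProduct (K := ℝ) p q) w
      = eval (fun i => w (Sum.inl i) + w (Sum.inr i)) (convolution p q) := by
  have h := eval_convolution_two_mul p q fun i => (w (Sum.inl i) + w (Sum.inr i)) / 2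
  rw [mixedDeriv, eval_foldr_pderiv hp hq] at h
  simp only [mul_div_cancel₀ _ (two_ne_zero' ℝ)] at h
  rw [show (fun i => w (Sum.inl i) + w (Sum.inr i))
    = fun i => 2 * ((w (Sum.inl i) + w (Sum.inr i)) / 2) by ext; ring]
  refine Eq.trans ?_ (Eq.trans h.symm ?_)
  -- Slide `(x, y)` to the diagonal point with both halves equal to `(x + y)/2`.
  · refine eq_of_forall_dependsOnSum (fun i => dependsOnSum_iterDiagDiff
      (separatelyAffine_pairProduct hp hq) _ (List.mem_finRange i)) fun i => ?_
    simp
  · congr 2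
    ext
    ring

end Polynomial

end StableConvolution

namespace StableConvolution

/-! ### Propagation over shifted orthants. -/

section Orthant

variable {ι : Type*} [DecidableEq ι] [Fintype ι]

theorem forall_ge_of_forall_add_single {S : (ι → ℝ) → Prop} {P : ι → ℝ} (h0 : S P)
    (hstep : ∀ z, P ≤ z → S z → ∀ j t, 0 ≤ t → S (z + Pi.single j t)) :
    ∀ z, P ≤ z → S z := by
  intro z hz
  have key : ∀ s : Finset ι, S (fun k => if k ∈ s then z k else P k) := by
    intro s
    induction s using Finset.induction_on with
    | empty => simpa using h0
    | insert a s ha ih =>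
      have h := hstep _ (fun k => by by_cases hk : k ∈ s <;> simp [hk, hz k]) ih a (z a - P a)
        (sub_nonneg.2 (hz a))
      convert h using 1
      ext k
      by_cases hk : k = a
      · subst hk; simp [ha]
      · simp [hk]
  simpa using key Finset.univ

theorem SeparatelyAffine.eq_zero_of_forall_ge {g : (ι → ℝ) → ℝ} (hg : SeparatelyAffine g)
    {P : ι → ℝ} (h : ∀ z, P ≤ z → g z = 0) : g = 0 := by
  have key : ∀ (s : Finset ι) (z : ι → ℝ), (∀ k, k ∉ s → P k ≤ z k) → g z = 0 := by
    intro s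
    induction s using Finset.induction_on with
    | empty => exact fun z hz => h z fun k => hz k (by simp)
    | insert a s ha ih =>
      intro z hz
      have hlarge : ∀ T, P a - z a ≤ T → g (z + Pi.single a T) = 0 := by
        intro T hT
        refine ih _ fun k hk => ?_
        by_cases hka : k = a
        · subst hka; simp; linarith
        · simpa [hka] using hz k (by simp [hka, hk])
      have h1 := hlarge _ le_rfl
      have h2 := hlarge (P a - z a + 1) (by linarith)
      rw [hg] at h1 h2
      have h3 : StableConvolution.partialDiff a g z = 0 := by linarith
      simpa [h3] using h1
  funext z
  exact key Finset.univ z (by simp)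

end Orthant

/-! ### Monotone potentials and the algebra of one barrier step. -/

section Barrier

variable {ι : Type*} [DecidableEq ι]

theorem nonneg_of_forall_add_mul_pos {α β : ℝ} (h : ∀ t, 0 ≤ t → 0 < α + t * β) : 0 ≤ β := by
  by_contra! hβ
  have hα : 0 < α := by simpa using h 0 le_rfl
  have := h (α / -β) (by apply div_nonneg <;> linarith)
  rw [div_neg, neg_mul, div_mul_cancel₀ _ hβ.ne] at this
  linarith

theorem le_add_single {P z : ι → ℝ} (hz : P ≤ z) (i : ι) {t : ℝ} (ht : 0 ≤ t) :
    P ≤ z + Pi.single i t :=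
  le_add_of_le_of_nonneg hz (Pi.single_nonneg.2 ht)

theorem SeparatelyAffine.partialDiff_nonneg {f : (ι → ℝ) → ℝ} (hf : SeparatelyAffine f)
    {P : ι → ℝ} (hpos : ∀ z, P ≤ z → 0 < f z) (i : ι) {z : ι → ℝ} (hz : P ≤ z) :
    0 ≤ StableConvolution.partialDiff i f z := by
  refine nonneg_of_forall_add_mul_pos (α := f z) fun t ht => ?_
  rw [← hf]
  exact hpos _ (le_add_single hz i ht)

/-- Along the ray in direction `i`, `∂ⱼf` is affine and stays nonnegative, so its slope cannot be
negative. -/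
theorem SeparatelyAffine.partialDiff_partialDiff_nonneg {f : (ι → ℝ) → ℝ}
    (hf : SeparatelyAffine f) {P : ι → ℝ} (hpos : ∀ z, P ≤ z → 0 < f z) (i j : ι) {z : ι → ℝ}
    (hz : P ≤ z) :
    0 ≤ StableConvolution.partialDiff i (StableConvolution.partialDiff j f) z := by
  by_contra! h
  have hj := hf.partialDiff_nonneg hpos j hz
  set d := StableConvolution.partialDiff i (StableConvolution.partialDiff j f) z with hd
  set e := StableConvolution.partialDiff j f z with he
  have ht : 0 ≤ (e + 1) / -d := by apply div_nonneg <;> linarith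
  have := hf.partialDiff_nonneg hpos j (le_add_single hz i ht)
  rw [hf.partialDiff j, ← hd, ← he, div_neg, neg_mul, div_mul_cancel₀ _ h.ne] at this
  linarith

/-- The Rayleigh inequality says that `∂ᵢf/f` decreases in direction `j ≠ i`; in direction `i` the
numerator is constant and `f` grows. -/
theorem IsRayleigh.partialDiff_le_mul [Fintype ι] {f : (ι → ℝ) → ℝ} (hR : IsRayleigh f)
    (hf : SeparatelyAffine f) {P : ι → ℝ} (hpos : ∀ z, P ≤ z → 0 < f z) {i : ι} {φ : ℝ}
    (h : partialDiff i f P ≤ φ * f P) : ∀ z, P ≤ z → partialDiff i f z ≤ φ * f z := by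
  refine forall_ge_of_forall_add_single h fun z hz hle j t ht => ?_
  have hA := hpos z hz
  have hB := hf.partialDiff_nonneg hpos i hz
  have hC := hf.partialDiff_nonneg hpos j hz
  by_cases hij : i = j
  · subst hij
    have hφ : 0 ≤ φ := by
      by_contra! hneg
      nlinarith
    rw [hf.partialDiff_self, hf]
    have : 0 ≤ φ * (t * partialDiff i f z) := by positivity
    linarith
  · have hr := hR j i (Ne.symm hij) z
    rw [hf.partialDiff i, hf]
    have h1 : partialDiff j (partialDiff i f) z ≤ φ * partialDiff j f z := by
      refine le_of_mul_le_mul_left ?_ hA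
      calc _ ≤ partialDiff j f z * partialDiff i f z := hr
        _ ≤ partialDiff j f z * (φ * f z) := mul_le_mul_of_nonneg_left hle hC
        _ = _ := by ring
    have h2 := mul_le_mul_of_nonneg_left h1 ht
    linarith

/-- The value `B + C - δD` of the differentiated function is positive at a suitable shift. -/
theorem shifted_pos {A B C D φ : ℝ} (hA : 0 < A) (hB : 0 ≤ B) (hC : 0 ≤ C) (hBC : 0 < B + C)
    (hφ : B + C ≤ φ * A) (hR : A * D ≤ B * C) : 0 < B + C - 1 / φ * D := by
  have hφ0 : 0 < φ := by
    by_contra! h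
    nlinarith
  -- Times `A`, this is at least `(B + C)² - BC`.
  have h1 : 0 < φ * (B + C) - D := by
    refine pos_of_mul_pos_right (a := A) ?_ hA.le
    nlinarith [mul_le_mul_of_nonneg_right hφ hBC.le, mul_pos hBC hBC, mul_nonneg hB hC]
  have : B + C - 1 / φ * D = (φ * (B + C) - D) / φ := by field_simp
  rw [this]
  positivity

/-- The claim amounts to `3D ≤ φ(B + C)`. Times `A`, the difference is at least `(B + C)² - 3BC = B²
- BC + C² ≥ 0`. -/
theorem shifted_self_le {A B C D φ : ℝ} (hA : 0 < A) (hBC : 0 < B + C)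
    (hφ : B + C ≤ φ * A) (hR : A * D ≤ B * C) : D ≤ φ / 2 * (B + C - 1 / φ * D) := by
  have hφ0 : 0 < φ := by
    by_contra! h
    nlinarith
  have h1 : φ / 2 * (B + C - 1 / φ * D) = (φ * (B + C) - D) / 2 := by field_simp
  rw [h1]
  have h2 : 0 ≤ A * (φ * (B + C) - 3 * D) := by
    nlinarith [mul_le_mul_of_nonneg_right hφ hBC.le, sq_nonneg (B - C), sq_nonneg (B + C)]
  have := nonneg_of_mul_nonneg_right h2 hA
  linarith

/-- Two of the Rayleigh inequalities for a polynomial in three variables bound the change of the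
potential in the third variable. -/
theorem shifted_other_le {A B C D A₁ B₁ C₁ D₁ φ Φ : ℝ} (hA : 0 < A) (hB : 0 ≤ B) (hC : 0 ≤ C)
    (hD : 0 ≤ D) (hBC : 0 < B + C) (hφ : B + C ≤ φ * A) (hR : A * D ≤ B * C)
    (hx : ∀ y, (A + y * C) * (B₁ + y * D₁) ≤ (B + y * D) * (A₁ + y * C₁))
    (hy : ∀ x, (A + x * B) * (C₁ + x * D₁) ≤ (C + x * D) * (A₁ + x * B₁))
    (hΦ : A₁ ≤ Φ * A) :
    B₁ + C₁ - 1 / φ * D₁ ≤ Φ * (B + C - 1 / φ * D) := by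
  have hφ0 : 0 < φ := by
    by_contra! h
    nlinarith
  have hS := shifted_pos hA hB hC hBC hφ hR
  -- Up to the factor `-A²`, `u` and `v` are the derivatives of the potential `A₁/A` in `x` and `y`.
  -- The goal reduces to `t ≤ φ(u + v)`.
  set u := A₁ * B - A * B₁ with hu
  set v := A₁ * C - A * C₁ with hv
  set t := A₁ * D - A * D₁ with ht
  have hu0 : 0 ≤ u := by have := hx 0; simp at this; linarith
  have hv0 : 0 ≤ v := by have := hy 0; simp at this; linarith
  -- Using the same shift `-δ` in both inequalities cancels the terms `BC₁ - CB₁` in their sum. The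
  -- value `δ = A/(B + C)` turns the `t`-part of the quadratic term, times `A`, into `δAt`, half of
  -- the linear term.
  have h1 := hx (-(A / (B + C)))
  have h2 := hy (-(A / (B + C)))
  have hsum : A * (D * C₁ - C * D₁ + (D * B₁ - B * D₁)) = (B + C) * t - D * (u + v) := by
    rw [hu, hv, ht]; ring
  have hcrit : A * t ≤ (B + C) * (u + v) := by
    set δ := A / (B + C) with hδ
    have hδA : δ * (B + C) = A := div_mul_cancel₀ _ hBC.ne'
    have h3 : 0 ≤ (u + v) - 2 * δ * t + δ * δ * (D * C₁ - C * D₁ + (D * B₁ - B * D₁)) := by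
      rw [hu, hv, ht]; nlinarith
    have h4 : 0 ≤ A * ((u + v) - δ * t) - δ * δ * D * (u + v) := by
      have h5 := mul_nonneg hA.le h3
      have h6 : A * (u + v - 2 * δ * t + δ * δ * (D * C₁ - C * D₁ + (D * B₁ - B * D₁)))
          = A * ((u + v) - δ * t) - δ * δ * D * (u + v) := by
        linear_combination δ * δ * hsum + δ * t * hδA
      rwa [h6] at h5
    have h7 : 0 ≤ δ * δ * D * (u + v) :=
      mul_nonneg (mul_nonneg (mul_self_nonneg δ) hD) (add_nonneg hu0 hv0)
    have h8 : 0 ≤ A * ((u + v) - δ * t) := by linarith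
    have h9 := mul_nonneg hBC.le (nonneg_of_mul_nonneg_right h8 hA)
    have h10 : (B + C) * (u + v - δ * t) = (B + C) * (u + v) - A * t := by
      linear_combination -t * hδA
    linarith
  have hmain : 1 / φ * t ≤ u + v := by
    have : t ≤ φ * (u + v) := by
      refine le_of_mul_le_mul_left ?_ hA
      nlinarith [mul_le_mul_of_nonneg_right hφ (add_nonneg hu0 hv0)]
    rw [one_div, inv_mul_le_iff₀ hφ0]
    exact this
  refine le_of_mul_le_mul_left ?_ hA
  calc A * (B₁ + C₁ - 1 / φ * D₁) = A₁ * (B + C - 1 / φ * D) - (u + v - 1 / φ * t) := by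
        rw [hu, hv, ht]; ring
    _ ≤ A₁ * (B + C - 1 / φ * D) := by linarith
    _ ≤ (Φ * A) * (B + C - 1 / φ * D) := mul_le_mul_of_nonneg_right hΦ hS.le
    _ = _ := by ring

end Barrier

/-! ### One operator, then all of them. -/

section Iteration

variable {κ : Type*} [DecidableEq κ] [Fintype κ]

/-- If both derivatives vanished at `z`, the potentials, being nonnegative and decreasing, would
vanish on the whole orthant above `z`, and a separately affine function that is zero there is zero.
-/
theorem pos_add_of_diagDiff_ne_zero {r : (κ ⊕ κ → ℝ) → ℝ} (hr : SeparatelyAffine r)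
    (hR : IsRayleigh r) {i : κ} {Q : κ ⊕ κ → ℝ} (hpos : ∀ z, Q ≤ z → 0 < r z)
    (hne : diagDiff i r ≠ 0) {z : κ ⊕ κ → ℝ} (hz : Q ≤ z) :
    0 < partialDiff (Sum.inl i) r z + partialDiff (Sum.inr i) r z := by
  have h0 := fun k {z} (hz : Q ≤ z) => hr.partialDiff_nonneg hpos k hz
  by_contra! hle
  refine hne ((hr.diagDiff i).eq_zero_of_forall_ge (P := z) fun w hw => ?_)
  have hzero : ∀ k, partialDiff k r z ≤ 0 → partialDiff k r w = 0 := by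
    intro k hk
    refine le_antisymm ?_ (h0 k (hz.trans hw))
    simpa using hR.partialDiff_le_mul hr (P := z) (fun w hw => hpos w (hz.trans hw)) (φ := 0)
      (i := k) (by simpa using hk) w hw
  have h1 := h0 (Sum.inl i) hz
  have h2 := h0 (Sum.inr i) hz
  rw [diagDiff, Pi.add_apply, hzero _ (by linarith), hzero _ (by linarith), add_zero]

theorem barrier_diagDiff {r : (κ ⊕ κ → ℝ) → ℝ} (hr : SeparatelyAffine r) (hR : IsRayleigh r)
    {i : κ} {Q : κ ⊕ κ → ℝ} {φ₁ φ₂ : ℝ} (hpos : ∀ z, Q ≤ z → 0 < r z)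
    (hx : ∀ z, Q ≤ z → partialDiff (Sum.inl i) r z ≤ φ₁ * r z)
    (hy : ∀ z, Q ≤ z → partialDiff (Sum.inr i) r z ≤ φ₂ * r z)
    (hne : diagDiff i r ≠ 0) {z : κ ⊕ κ → ℝ}
    (hz : Q ≤ z + Pi.single (Sum.inl i) (1 / (φ₁ + φ₂))) :
    0 < diagDiff i r z ∧
    partialDiff (Sum.inl i) (diagDiff i r) z ≤ (φ₁ + φ₂) / 2 * diagDiff i r z ∧
    partialDiff (Sum.inr i) (diagDiff i r) z ≤ (φ₁ + φ₂) / 2 * diagDiff i r z ∧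
    ∀ k Φ, k ≠ Sum.inl i → k ≠ Sum.inr i → (∀ w, Q ≤ w → partialDiff k r w ≤ Φ * r w) →
      partialDiff k (diagDiff i r) z ≤ Φ * diagDiff i r z := by
  set x : κ ⊕ κ := Sum.inl i with hxdef
  set y : κ ⊕ κ := Sum.inr i with hydef
  have hxy : x ≠ y := by simp [hxdef, hydef]
  set φ := φ₁ + φ₂ with hφdef
  -- The data are known at `w`, above the old roots; values at `z` follow by exact affine expansion
  -- in `x`.
  set w := z + Pi.single x (1 / φ) with hw
  have hzw : z = w + Pi.single x (-(1 / φ)) := by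
    rw [hw, add_assoc, ← Pi.single_add]
    simp
  have hA := hpos w hz
  have hB := hr.partialDiff_nonneg hpos x hz
  have hC := hr.partialDiff_nonneg hpos y hz
  have hD := hr.partialDiff_partialDiff_nonneg hpos x y hz
  have hBC : 0 < partialDiff x r w + partialDiff y r w :=
    pos_add_of_diagDiff_ne_zero hr hR hpos hne hz
  have hφ : partialDiff x r w + partialDiff y r w ≤ φ * r w := by
    have := hx w hz
    have := hy w hz
    rw [hφdef, add_mul]
    linarith
  have hRxy := hR x y hxy w
  -- values at the shifted point
  have hval : ∀ g : (κ ⊕ κ → ℝ) → ℝ, SeparatelyAffine g →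
      partialDiff x g z + partialDiff y g z
        = partialDiff x g w + partialDiff y g w - 1 / φ * partialDiff x (partialDiff y g) w := by
    intro g hg
    rw [hzw, hg.partialDiff_self, hg.partialDiff y]
    ring
  have hS : diagDiff i r z = _ := hval r hr
  have hself : partialDiff x (diagDiff i r) z = partialDiff x (partialDiff y r) w := by
    rw [partialDiff_diagDiff, Pi.add_apply, hr.partialDiff_partialDiff_self, zero_add,
      partialDiff_comm, hzw, (hr.partialDiff y).partialDiff_self]
  have hself' : partialDiff y (diagDiff i r) z = partialDiff x (partialDiff y r) w := by
    rw [partialDiff_diagDiff, Pi.add_apply, hr.partialDiff_partialDiff_self, add_zero,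
      hzw, (hr.partialDiff y).partialDiff_self]
  rw [hself, hself', hS]
  refine ⟨shifted_pos hA hB hC hBC hφ hRxy, shifted_self_le hA hBC hφ hRxy,
    shifted_self_le hA hBC hφ hRxy, fun k Φ hkx hky hk => ?_⟩
  rw [partialDiff_diagDiff, Pi.add_apply, hval _ (hr.partialDiff k)]
  refine shifted_other_le hA hB hC hD hBC hφ hRxy (fun s => ?_) (fun s => ?_) (hk w hz)
  · have h := hR x k hkx.symm (w + Pi.single y s)
    rw [hr, hr.partialDiff x, hr.partialDiff k, (hr.partialDiff k).partialDiff x,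
      partialDiff_comm y x, partialDiff_comm y x] at h
    exact h
  · have h := hR y k hky.symm (w + Pi.single x s)
    rw [hr, hr.partialDiff y, hr.partialDiff k, (hr.partialDiff k).partialDiff y] at h
    exact h

/-- The untreated variables must keep their original bounds `φ₁`, `φ₂`, so that each step shifts by
the same amount; absence of repetitions in the list guarantees that each operator meets an untreated
pair. -/
theorem barrier_iterDiagDiff {f : (κ ⊕ κ → ℝ) → ℝ} (hf : SeparatelyAffine f)
    (hR : ∀ L, IsRayleigh (iterDiagDiff L f)) {P : κ ⊕ κ → ℝ} {φ₁ φ₂ : ℝ}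
    (hpos : ∀ z, P ≤ z → 0 < f z)
    (hx : ∀ i, partialDiff (Sum.inl i) f P ≤ φ₁ * f P)
    (hy : ∀ i, partialDiff (Sum.inr i) f P ≤ φ₂ * f P)
    (L : List κ) (hL : L.Nodup) (hne : iterDiagDiff L f ≠ 0) :
    ∀ z, (∀ i, P (Sum.inl i) - (if i ∈ L then 1 / (φ₁ + φ₂) else 0) ≤ z (Sum.inl i)) →
      (∀ i, P (Sum.inr i) ≤ z (Sum.inr i)) →
      0 < iterDiagDiff L f z ∧
      (∀ i, partialDiff (Sum.inl i) (iterDiagDiff L f) z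
        ≤ (if i ∈ L then (φ₁ + φ₂) / 2 else φ₁) * iterDiagDiff L f z) ∧
      (∀ i, partialDiff (Sum.inr i) (iterDiagDiff L f) z
        ≤ (if i ∈ L then (φ₁ + φ₂) / 2 else φ₂) * iterDiagDiff L f z) := by
  induction L with
  | nil =>
    intro z h1 h2
    have hz : P ≤ z := by
      rintro (i | i)
      · simpa using h1 i
      · exact h2 i
    refine ⟨hpos z hz, fun i => ?_, fun i => ?_⟩
    · simpa using (hR []).partialDiff_le_mul hf hpos (hx i) z hz
    · simpa using (hR []).partialDiff_le_mul hf hpos (hy i) z hz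
  | cons a L ih =>
    have hne' : iterDiagDiff L f ≠ 0 := by
      intro h
      refine hne ?_
      funext z
      change diagDiff a (iterDiagDiff L f) z = 0
      simp [h, diagDiff, partialDiff]
    obtain ⟨haL, hL'⟩ := List.nodup_cons.1 hL
    have ih := ih hL' hne'
    set r := iterDiagDiff L f with hr
    set Q : κ ⊕ κ → ℝ := Sum.elim
      (fun i => P (Sum.inl i) - (if i ∈ L then 1 / (φ₁ + φ₂) else 0)) (fun i => P (Sum.inr i))
      with hQ
    have ihQ := fun z (hz : Q ≤ z) => ih z (fun i => hz (Sum.inl i)) (fun i => hz (Sum.inr i))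
    intro z h1 h2
    have hz : Q ≤ z + Pi.single (Sum.inl a) (1 / (φ₁ + φ₂)) := by
      rintro (i | i)
      · have := h1 i
        by_cases hia : i = a
        · subst hia
          simp only [List.mem_cons, true_or, if_true] at this
          simp only [hQ, Sum.elim_inl, haL, if_false, Pi.add_apply, Pi.single_eq_same]
          linarith
        · simpa [hQ, hia] using this
      · simpa [hQ] using h2 i
    obtain ⟨b1, b2, b3, b4⟩ := barrier_diagDiff (hf.iterDiagDiff L) (hR L) (i := a)
      (fun z hz => (ihQ z hz).1)
      (fun z hz => by simpa [haL] using (ihQ z hz).2.1 a)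
      (fun z hz => by simpa [haL] using (ihQ z hz).2.2 a) hne hz
    change 0 < diagDiff a r z ∧ (∀ i, partialDiff (Sum.inl i) (diagDiff a r) z ≤ _ * diagDiff a r z) ∧
      (∀ i, partialDiff (Sum.inr i) (diagDiff a r) z ≤ _ * diagDiff a r z)
    refine ⟨b1, fun i => ?_, fun i => ?_⟩
    · by_cases hia : i = a
      · subst hia; simpa using b2
      · simpa [hia] using b4 (Sum.inl i) _ (by simpa using hia) (by simp)
          (fun w hw => (ihQ w hw).2.1 i)
    · by_cases hia : i = a
      · subst hia; simpa using b3
      · simpa [hia] using b4 (Sum.inr i) _ (by simp) (by simpa using hia)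
          (fun w hw => (ihQ w hw).2.2 i)

end Iteration

/-! ### Assembly for `p ∗ q`. -/

section Main

open MvPolynomial

variable {κ : Type*} [DecidableEq κ]

theorem iterDiagDiff_const_mul {K : Type*} [CommRing K] (c : K) (f : (κ ⊕ κ → K) → K)
    (L : List κ) : iterDiagDiff L (fun z => c * f z) = fun z => c * iterDiagDiff L f z := by
  induction L with
  | nil => rfl
  | cons i L ih =>
    funext z
    simp only [iterDiagDiff, List.foldr_cons] at ih ⊢
    rw [ih]
    simp only [diagDiff, partialDiff, Pi.add_apply]
    ring

theorem IsRayleigh.const_mul {ι : Type*} [DecidableEq ι] {f : (ι → ℝ) → ℝ} (hf : IsRayleigh f)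
    (c : ℝ) : IsRayleigh (fun z => c * f z) := by
  intro i j hij z
  have := mul_le_mul_of_nonneg_left (hf i j hij z) (mul_self_nonneg c)
  simp only [partialDiff] at this ⊢
  linarith

/-- A sign change on the segment from `a` to `z` would produce a root above `a`. -/
theorem AboveRoots.mul_pos {n : ℕ} {p : MvPolynomial (Fin n) ℝ} {a : Fin n → ℝ}
    (ha : AboveRoots p a) {z : Fin n → ℝ} (hz : a ≤ z) : 0 < eval a p * eval z p := by
  have hcont : Continuous fun s : ℝ => eval (a + s • (z - a)) p := by
    simp only [eval_eq']
    fun_prop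
  have hne : ∀ s : ℝ, 0 ≤ s → eval (a + s • (z - a)) p ≠ 0 := fun s hs =>
    ha _ fun i => mul_nonneg hs (sub_nonneg.2 (hz i))
  have h0 : eval a p ≠ 0 := by simpa using hne 0 le_rfl
  have h1 : eval z p ≠ 0 := by simpa using hne 1 zero_le_one
  by_contra! hle
  have hlt := lt_of_le_of_ne hle (mul_ne_zero h0 h1)
  have hmem : (0 : ℝ) ∈ Set.uIcc (eval (a + (0 : ℝ) • (z - a)) p)
      (eval (a + (1 : ℝ) • (z - a)) p) := by
    rw [Set.mem_uIcc]
    simp only [zero_smul, add_zero, one_smul, add_sub_cancel]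
    rcases mul_neg_iff.1 hlt with h | h
    · exact Or.inr ⟨h.2.le, h.1.le⟩
    · exact Or.inl ⟨h.1.le, h.2.le⟩
  obtain ⟨s, hs, hs0⟩ := intermediate_value_uIcc hcont.continuousOn hmem
  rw [Set.uIcc_of_le zero_le_one] at hs
  exact hne s hs.1 hs0

theorem barrier_convolution {n : ℕ} {p q : MvPolynomial (Fin n) ℝ}
    (hp : IsMultiaffine p) (hps : IsRealStable p) (hq : IsMultiaffine q) (hqs : IsRealStable q)
    (hpq : convolution p q ≠ 0) {a b : Fin n → ℝ} (ha : AboveRoots p a) (hb : AboveRoots q b)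
    {φ₁ φ₂ : ℝ} (hφ₁ : ∀ i, potential p i a ≤ φ₁) (hφ₂ : ∀ i, potential q i b ≤ φ₂)
    {c : Fin n → ℝ} (hc : ∀ i, c i = a i + b i - 1 / (φ₁ + φ₂)) :
    AboveRoots (convolution p q) c ∧
      ∀ i, potential (convolution p q) i c ≤ (φ₁ + φ₂) / 2 := by
  -- Multiplying by `k` fixes the signs: `k p(x) q(y) > 0` for `x ≥ a`, `y ≥ b`, and potentials do
  -- not change.
  set k := eval a p * eval b q with hk
  have hk0 : k ≠ 0 := mul_ne_zero (by simpa using ha 0 (by simp)) (by simpa using hb 0 (by simp))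
  set g := pairProduct (K := ℝ) p q with hg
  have hga : SeparatelyAffine g := separatelyAffine_pairProduct hp hq
  have hgval : ∀ z, g z = eval (fun i => z (Sum.inl i)) p * eval (fun i => z (Sum.inr i)) q :=
    fun z => by simp [hg, pairProduct, aeval_eq_eval]
  set r := iterDiagDiff (List.finRange n) g with hr
  have hra : SeparatelyAffine r := hga.iterDiagDiff _
  have hrval : ∀ x y : Fin n → ℝ, r (Sum.elim x y) = eval (x + y) (convolution p q) :=
    fun x y => iterDiagDiff_pairProduct hp hq (Sum.elim x y)
  have hle : ∀ {u : MvPolynomial (Fin n) ℝ} {x : Fin n → ℝ} {φ : ℝ} {i : Fin n},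
      AboveRoots u x → potential u i x ≤ φ →
      eval x u * eval x (pderiv i u) ≤ φ * (eval x u * eval x u) := by
    intro u x φ i hu h
    have hu0 : eval x u ≠ 0 := by simpa using hu 0 (by simp)
    calc eval x u * eval x (pderiv i u) = potential u i x * (eval x u * eval x u) := by
          rw [potential]; field_simp
      _ ≤ _ := mul_le_mul_of_nonneg_right h (mul_self_nonneg _)
  have key := barrier_iterDiagDiff (f := fun z => k * g z) (hga.const_mul k)
    (fun L => by
      rw [iterDiagDiff_const_mul]
      exact (isRayleigh_iterDiagDiff_pairProduct hp hq hps hqs L).const_mul k)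
    (P := Sum.elim a b) (φ₁ := φ₁) (φ₂ := φ₂)
    (fun z hz => by
      have h1 := ha.mul_pos (z := fun i => z (Sum.inl i)) fun i => hz (Sum.inl i)
      have h2 := hb.mul_pos (z := fun i => z (Sum.inr i)) fun i => hz (Sum.inr i)
      rw [hgval, hk]
      linarith [_root_.mul_pos h1 h2])
    (fun i => by
      have h := mul_le_mul_of_nonneg_right (hle ha (hφ₁ i)) (mul_self_nonneg (eval b q))
      rw [hp.eval_pderiv] at h
      simp only [partialDiff, hg, pairProduct_add_single_inl] at h ⊢
      simp only [pairProduct, Sum.elim_inl, Sum.elim_inr, aeval_eq_eval] at h ⊢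
      linarith)
    (fun i => by
      have h := mul_le_mul_of_nonneg_right (hle hb (hφ₂ i)) (mul_self_nonneg (eval a p))
      rw [hq.eval_pderiv] at h
      simp only [partialDiff, hg, pairProduct_add_single_inr] at h ⊢
      simp only [pairProduct, Sum.elim_inl, Sum.elim_inr, aeval_eq_eval] at h ⊢
      linarith)
    (List.finRange n) (List.nodup_finRange n)
    (fun h0 => hpq <| MvPolynomial.funext fun x => by
      have := congrFun h0 (Sum.elim x 0)
      rw [iterDiagDiff_const_mul] at this
      simpa [hk0, ← hr, hrval] using this)
  rw [iterDiagDiff_const_mul, ← hr] at key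
  -- The point `(c + t - b, b)` has sum `c + t`, and its first half is at least `a - 1/(φ₁ + φ₂)` in
  -- each coordinate.
  have key' : ∀ t : Fin n → ℝ, (∀ i, 0 ≤ t i) → _ := fun t ht =>
    key (Sum.elim (c + t - b) b)
      (fun i => by
        simp only [List.mem_finRange, if_true, Sum.elim_inl, Pi.add_apply, Pi.sub_apply, hc]
        linarith [ht i])
      (fun i => le_rfl)
  refine ⟨fun t ht h0 => ?_, fun i => ?_⟩
  · have := (key' t ht).1
    simp [hrval, h0] at this
  · obtain ⟨h1, h2, -⟩ := key' 0 fun _ => le_rfl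
    have h2 := h2 i
    have hd : eval c (pderiv i (convolution p q)) = partialDiff (Sum.inl i) r
        (Sum.elim (c - b) b) := by
      refine eval_pderiv_eq_of_forall (α := r (Sum.elim (c - b) b)) (γ := 0) fun t => ?_
      rw [mul_zero, add_zero, ← hra]
      have hs : Sum.elim (c - b) b + Pi.single (Sum.inl i) t
          = Sum.elim (c - b + Pi.single i t) b := by
        ext (j | j)
        · by_cases h : j = i <;> simp [h]
        · simp
      rw [hs, hrval]
      congr 2
      abel
    have hpd : partialDiff (Sum.inl i) (fun z => k * r z) (Sum.elim (c - b) b)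
        = k * eval c (pderiv i (convolution p q)) := by
      rw [hd]
      simp only [partialDiff]
      ring
    simp only [List.mem_finRange, if_true, add_zero, hpd, hrval, sub_add_cancel] at h1 h2
    rw [potential, ← mul_div_mul_left _ _ hk0, div_le_iff₀ h1]
    exact h2

end Main

end StableConvolution

theorem mainTheorem6 (n : ℕ) (p q : MvPolynomial (Fin n) ℝ)
    (hp_affine : StableConvolution.IsMultiaffine p)
    (hp_stable : StableConvolution.IsRealStable p)
    (hq_affine : StableConvolution.IsMultiaffine q)
    (hq_stable : StableConvolution.IsRealStable q)
    (hpq : StableConvolution.convolution p q ≠ 0)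
    (a b : Fin n → ℝ)
    (ha : StableConvolution.AboveRoots p a)
    (hb : StableConvolution.AboveRoots q b)
    (φ₁ φ₂ : ℝ)
    (hφ₁ : ∀ i, StableConvolution.potential p i a ≤ φ₁)
    (hφ₂ : ∀ i, StableConvolution.potential q i b ≤ φ₂)
    (c : Fin n → ℝ)
    (hc : ∀ i, c i = a i + b i - 1 / (φ₁ + φ₂)) :
    StableConvolution.AboveRoots (StableConvolution.convolution p q) c ∧
      ∀ i, StableConvolution.potential (StableConvolution.convolution p q) i c
        ≤ (φ₁ + φ₂) / 2 :=
  StableConvolution.barrier_convolution hp_affine hp_stable hq_affine hq_stable hpq ha hb hφ₁ hφ₂ hc
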